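/- Let $\mathcal C=\{x\in\mathbb R^n: l\le x\le u\}$ be a box with $l\le u$, let $f:\mathbb R^n\times\mathbb R^n\to\mathbb R$ be continuous with $f(x,\cdot)$ convex and $f(x,x)=0$ for all $x\in\mathcal C$, let $\alpha\ge 0$, and let $$\varphi_\alpha(x)=\max_{y\in\mathcal C}\Big[-f(x,y)-\frac{\alpha}{2}\|y-x\|^2\Big].$$ Both algorithms below produce finite partitions $\mathcal H_0=\{\mathcal C\},\mathcal H_1,\mathcal H_2,\dots$ of $\mathcal C$ into boxes $\mathcal C^i=\{x: l^i\le x\le u^i\}$, $i\in I_k$, with centroids $x^i=(l^i+u^i)/2$, the points sampled by the algorithm. At iteration $k$ all boxes with index in a set $I_k^*\subseteq I_k$ are selected and divided, the other boxes are kept, and this gives $\mathcal H_{k+1}$. A selected box $\mathcal C^h$ is divided as follows: for each coordinate $j$ along which it has a longest side, put $\delta_j=(u^h_j-l^h_j)/3$ and $w_j=\min\{\varphi_\alpha(x^h+\delta_je_j),\varphi_\alpha(x^h-\delta_je_j)\}$; going through these coordinates by nondecreasing $w_j$ (ties broken arbitrarily), trisect the box along the first one, then its middle third along the second one, and so on.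 Side lengths are compared in fixed arbitrary units $s_j>0$, i.e. through $(u^h_j-l^h_j)/s_j$ ($s_j=1$: actual lengths; $s_j=u_j-l_j$: lengths after normalization of $\mathcal C$ to the unit cube). Let $\varphi_{\min}=\min_{i\in I_k}\varphi_\alpha(x^i)$. * In standard DIRECT, with a parameter $\varepsilon>0$, $I_k^*$ is the set of all $h\in I_k$ for which there is a constant $K>0$ with $$\varphi_\alpha(x^h)-\tfrac K2\|u^h-l^h\|\le\varphi_\alpha(x^i)-\tfrac K2\|u^i-l^i\|\quad\forall i\in I_k,\qquad \varphi_\alpha(x^h)-\tfrac K2\|u^h-l^h\|\le\varphi_{\min}-\varepsilon|\varphi_{\min}|.$$ * In $\bar L$-DIRECT, with parameters $\varepsilon',\eta,\bar L>0$, $I_k^*$ is the set of all $h\in I_k$ such that either there is $K\in(0,\bar L)$ with $$\varphi_\alpha(x^h)-\tfrac K2\|u^h-l^h\|\le\varphi_\alpha(x^i)-\tfrac K2\|u^i-l^i\|\quad\forall i\in I_k,\qquad \varphi_\alpha(x^h)-\tfrac K2\|u^h-l^h\|\le\varphi_{\min}-\varepsilon'\max\{|\varphi_{\min}|,\eta\},$$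 or $$\varphi_\alpha(x^h)-\tfrac{\bar L}2\|u^h-l^h\|\le\varphi_\alpha(x^i)-\tfrac{\bar L}2\|u^i-l^i\|\quad\forall i\in I_k.$$ Assumption 1 (on a run of $\bar L$-DIRECT): for every global minimum point $x^*$ of $\varphi_\alpha$ over $\mathcal C$ there are an iteration $\bar k$ and a box $\mathcal C^j\in\mathcal H_{\bar k}$ with $x^*\in\mathcal C^j$ such that $L<\bar L$, where $L$ is the (best) Lipschitz constant of $\varphi_\alpha$ over $\mathcal C^j$. Then for every run of standard DIRECT and every run of $\bar L$-DIRECT the following hold. 1. For every global minimum point $x^*$ of $\varphi_\alpha$ over $\mathcal C$ and every neighborhood $\mathcal B(x^*)$ of $x^*$ there is an index $\bar k$ such that the partition $\mathcal H_{\bar k}$ of DIRECT contains a box whose centroid lies in $\mathcal B(x^*)$. 2. If Assumption 1 holds, then for every global minimum point $x^*$ of $\varphi_\alpha$ over $\mathcal C$ and every neighborhood $\mathcal B(x^*)$ of $x^*$ there is an index $\bar k$ such that the $\bar k$-th partition of DIRECT and the $\bar k$-th partition of $\bar L$-DIRECT each contain a box whose centroid lies in $\mathcal B(x^*)$. -/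

import Mathlib

open Topology
open scoped NNReal ENNReal

/-- The gap function `φ_α(x) = max_{y ∈ C} [-f(x,y) - (α/2) ‖y - x‖²]` of the equilibrium problem
given by the bifunction `f` on the set `C`.  (For `f` continuous and `C` compact and nonempty the
supremum is attained.) -/
noncomputable def gapFunction {n : ℕ}
    (f : EuclideanSpace ℝ (Fin n) → EuclideanSpace ℝ (Fin n) → ℝ)
    (C : Set (EuclideanSpace ℝ (Fin n))) (α : ℝ) (x : EuclideanSpace ℝ (Fin n)) : ℝ :=
  sSup ((fun y => -f x y - α / 2 * ‖y - x‖ ^ 2) '' C)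

/-- `x` is a global minimum point of the problem `min φ` over `C`. -/
def IsGlobalMinPoint {n : ℕ} (φ : EuclideanSpace ℝ (Fin n) → ℝ)
    (C : Set (EuclideanSpace ℝ (Fin n))) (x : EuclideanSpace ℝ (Fin n)) : Prop :=
  x ∈ C ∧ ∀ y ∈ C, φ x ≤ φ y

/-- The best Lipschitz constant (for the Euclidean norm) of `φ` over `S`;
it is `∞` if `φ` is not Lipschitz on `S`. -/
noncomputable def lipConst {n : ℕ} (φ : EuclideanSpace ℝ (Fin n) → ℝ)
    (S : Set (EuclideanSpace ℝ (Fin n))) : ℝ≥0∞ :=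
  ⨅ (K : ℝ≥0) (_ : LipschitzOnWith K φ S), (K : ℝ≥0∞)

/-- Data of a box `{x : lo ≤ x ≤ hi}` in `ℝⁿ`. -/
@[ext]
structure Cell (n : ℕ) where
  lo : Fin n → ℝ
  hi : Fin n → ℝ

namespace Cell

variable {n : ℕ}

/-- The box itself. -/
def toSet (c : Cell n) : Set (EuclideanSpace ℝ (Fin n)) :=
  {x | ∀ i, c.lo i ≤ x i ∧ x i ≤ c.hi i}

/-- The centroid `(lo + hi) / 2`. -/
noncomputable def center (c : Cell n) : EuclideanSpace ℝ (Fin n) :=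
  WithLp.toLp 2 (fun i => (c.lo i + c.hi i) / 2)

/-- The Euclidean length `‖hi - lo‖` of the diagonal. -/
noncomputable def diag (c : Cell n) : ℝ :=
  ‖(WithLp.toLp 2 (fun i => c.hi i - c.lo i) : EuclideanSpace ℝ (Fin n))‖

/-- The length of the `i`-th side. -/
def side (c : Cell n) (i : Fin n) : ℝ := c.hi i - c.lo i

/-- The lower third of the box along coordinate `i`. -/
noncomputable def lowerThird (c : Cell n) (i : Fin n) : Cell n :=
  ⟨c.lo, Function.update c.hi i (c.lo i + c.side i / 3)⟩

/-- The middle third of the box along coordinate `i`. -/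
noncomputable def middleThird (c : Cell n) (i : Fin n) : Cell n :=
  ⟨Function.update c.lo i (c.lo i + c.side i / 3),
    Function.update c.hi i (c.hi i - c.side i / 3)⟩

/-- The upper third of the box along coordinate `i`. -/
noncomputable def upperThird (c : Cell n) (i : Fin n) : Cell n :=
  ⟨Function.update c.lo i (c.hi i - c.side i / 3), c.hi⟩

/-- Divide a box into thirds successively along the coordinates of a list: the box is trisected
along the first coordinate, then its middle third along the second coordinate, and so on. -/
noncomputable def divide : List (Fin n) → Cell n → Set (Cell n)
  | [], c => {c}
  | i :: is, c => {c.lowerThird i, c.upperThird i} ∪ divide is (c.middleThird i)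

/-- Coordinate `i` is a longest side of the box, side lengths being measured in the units `s`:
`s = 1` compares the actual lengths, `s = u - l` compares the lengths after the feasible box
`[l,u]` has been normalized to the unit cube. -/
def IsLongest (s : Fin n → ℝ) (c : Cell n) (i : Fin n) : Prop :=
  ∀ j, c.side j / s j ≤ c.side i / s i

/-- The value `w_i = min {φ(c + δ_i e_i), φ(c - δ_i e_i)}`, where `c` is the centroid and `δ_i` is
one third of the `i`-th side. -/
noncomputable def sampleValue (φ : EuclideanSpace ℝ (Fin n) → ℝ) (c : Cell n) (i : Fin n) : ℝ :=
  min (φ (c.center + EuclideanSpace.single i (c.side i / 3)))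
    (φ (c.center - EuclideanSpace.single i (c.side i / 3)))

/-- `is` lists the coordinates of the longest sides of the box, each once, by nondecreasing `w_i`
(ties may be broken in any way). -/
def IsDivisionOrder (φ : EuclideanSpace ℝ (Fin n) → ℝ) (s : Fin n → ℝ) (c : Cell n)
    (is : List (Fin n)) : Prop :=
  is.Nodup ∧ (∀ i, i ∈ is ↔ c.IsLongest s i) ∧
    is.Pairwise (fun i j => c.sampleValue φ i ≤ c.sampleValue φ j)

end Cell

/-- `φ_min`, the smallest value of `φ` at the centroids of a (finite, nonempty) partition. -/
noncomputable def phiMin {n : ℕ} (φ : EuclideanSpace ℝ (Fin n) → ℝ) (H : Set (Cell n)) : ℝ :=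
  sInf ((fun c => φ c.center) '' H)

/-- The cell `h` of the partition `H` is potentially optimal with respect to `φ`. -/
def PotentiallyOptimal {n : ℕ} (φ : EuclideanSpace ℝ (Fin n) → ℝ) (ε : ℝ)
    (H : Set (Cell n)) (h : Cell n) : Prop :=
  ∃ K : ℝ, 0 < K ∧
    (∀ c ∈ H, φ h.center - K / 2 * h.diag ≤ φ c.center - K / 2 * c.diag) ∧
    φ h.center - K / 2 * h.diag ≤ phiMin φ H - ε * |phiMin φ H|

/-- The cell `h` of the partition `H` is `Lbar`-potentially optimal with respect to `φ`. -/
def LbarPotentiallyOptimal {n : ℕ} (φ : EuclideanSpace ℝ (Fin n) → ℝ) (ε η Lbar : ℝ)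
    (H : Set (Cell n)) (h : Cell n) : Prop :=
  (∃ K : ℝ, 0 < K ∧ K < Lbar ∧
    (∀ c ∈ H, φ h.center - K / 2 * h.diag ≤ φ c.center - K / 2 * c.diag) ∧
    φ h.center - K / 2 * h.diag ≤ phiMin φ H - ε * max |phiMin φ H| η) ∨
  (∀ c ∈ H, φ h.center - Lbar / 2 * h.diag ≤ φ c.center - Lbar / 2 * c.diag)

/-- `H 0, H 1, H 2, …` are the partitions produced by the partition-based method which starts from
the box `[l,u]`, selects in every partition `P` all the cells `c` with `sel P c`, and divides the
selected cells into thirds along all their longest sides in the order of the sampled values. -/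
def IsPartitionRun {n : ℕ} (φ : EuclideanSpace ℝ (Fin n) → ℝ) (s l u : Fin n → ℝ)
    (sel : Set (Cell n) → Cell n → Prop) (H : ℕ → Set (Cell n)) : Prop :=
  H 0 = {⟨l, u⟩} ∧
  ∀ k, ∃ order : Cell n → List (Fin n),
    (∀ c ∈ H k, sel (H k) c → c.IsDivisionOrder φ s (order c)) ∧
    H (k + 1) = {c | c ∈ H k ∧ ¬ sel (H k) c} ∪
      ⋃ c ∈ {c | c ∈ H k ∧ sel (H k) c}, Cell.divide (order c) c

/-- A run of the standard DIRECT algorithm. -/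
def IsDirectRun {n : ℕ} (φ : EuclideanSpace ℝ (Fin n) → ℝ) (s l u : Fin n → ℝ) (ε : ℝ)
    (H : ℕ → Set (Cell n)) : Prop :=
  IsPartitionRun φ s l u (PotentiallyOptimal φ ε) H

/-- A run of the `Lbar`-DIRECT algorithm. -/
def IsLbarDirectRun {n : ℕ} (φ : EuclideanSpace ℝ (Fin n) → ℝ) (s l u : Fin n → ℝ)
    (ε η Lbar : ℝ) (H : ℕ → Set (Cell n)) : Prop :=
  IsPartitionRun φ s l u (LbarPotentiallyOptimal φ ε η Lbar) H

/-- For every global minimum point there are an iteration and a cell of its partition containing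
the point, such that `Lbar` overestimates the local Lipschitz constant of `φ` over this cell. -/
def OverestimatesLocally {n : ℕ} (φ : EuclideanSpace ℝ (Fin n) → ℝ)
    (C : Set (EuclideanSpace ℝ (Fin n))) (Lbar : ℝ) (H : ℕ → Set (Cell n)) : Prop :=
  ∀ x, IsGlobalMinPoint φ C x →
    ∃ k, ∃ c ∈ H k, x ∈ c.toSet ∧ lipConst φ c.toSet < ENNReal.ofReal Lbar

/-! The core is a termination argument valid for any selection rule: for fixed `δ > 0`, cells of
diagonal at least `δ` cannot be selected in every iteration from some index on
(`not_forall_exists_sel`). Dividing such a cell lowers the squared diagonal by a fixed `γ` and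
yields at most `2n + 1` parts, so a weight exponential in the squared diagonal strictly decreases.

Suppose now that no centroid enters the ball of radius `r` about a minimum point `x`. The cell
containing `x` then always has diagonal at least `r`. DIRECT selects a cell of largest diagonal in
every iteration, a contradiction. The other method selects a minimizer `h` of `φ - Lbar / 2 * diag`;
comparison with the cell containing `x`, on which `φ` has a Lipschitz constant `L < Lbar`, gives
`Lbar * h.diag ≥ (Lbar - L) * r`, again a contradiction. -/

namespace Cell

/-! ### Geometry of boxes and of their trisection. -/

variable {n : ℕ}

/-- The sides of the box have nonnegative length. -/
def Proper (c : Cell n) : Prop := ∀ i, c.lo i ≤ c.hi i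

/-- The bounds of `d` lie between those of `c`. -/
def Within (d c : Cell n) : Prop := ∀ i, c.lo i ≤ d.lo i ∧ d.hi i ≤ c.hi i

lemma Within.refl (c : Cell n) : c.Within c := fun _ => ⟨le_rfl, le_rfl⟩

lemma Within.trans {c d e : Cell n} (h : c.Within d) (h' : d.Within e) : c.Within e :=
  fun i => ⟨(h' i).1.trans (h i).1, (h i).2.trans (h' i).2⟩

lemma Within.toSet_subset {c d : Cell n} (h : c.Within d) : c.toSet ⊆ d.toSet :=
  fun _ hx i => ⟨(h i).1.trans (hx i).1, (hx i).2.trans (h i).2⟩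

lemma Within.side_le {c d : Cell n} (h : c.Within d) (i : Fin n) : c.side i ≤ d.side i := by
  have := h i
  simp only [side]
  linarith

lemma Proper.side_nonneg {c : Cell n} (hc : c.Proper) (i : Fin n) : 0 ≤ c.side i :=
  sub_nonneg.2 (hc i)

lemma Proper.center_mem {c : Cell n} (hc : c.Proper) : c.center ∈ c.toSet := by
  intro i
  have := hc i
  simp only [center]
  constructor <;> linarith

lemma diag_nonneg (c : Cell n) : 0 ≤ c.diag := norm_nonneg _

lemma diag_sq (c : Cell n) : c.diag ^ 2 = ∑ i, c.side i ^ 2 := by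
  simp [diag, side, EuclideanSpace.norm_sq_eq]

lemma dist_center_le {c : Cell n} {x : EuclideanSpace ℝ (Fin n)} (hx : x ∈ c.toSet) :
    dist c.center x ≤ c.diag / 2 := by
  refine le_of_sq_le_sq ?_ (by have := c.diag_nonneg; positivity)
  rw [div_pow, diag_sq, EuclideanSpace.dist_eq, Real.sq_sqrt (by positivity), Finset.sum_div]
  refine Finset.sum_le_sum fun i _ => ?_
  have h := hx i
  simp only [center, Real.dist_eq, sq_abs, side]
  -- With `m` the midpoint of the side, `(side / 2)² - (m - x)² = (x - lo) * (hi - x)`.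
  nlinarith [mul_nonneg (sub_nonneg.2 h.1) (sub_nonneg.2 h.2)]

lemma lowerThird_spec {c : Cell n} (hc : c.Proper) (i : Fin n) :
    (c.lowerThird i).Proper ∧ (c.lowerThird i).Within c ∧ (c.lowerThird i).side i = c.side i / 3 := by
  refine ⟨fun j => ?_, fun j => ?_, by simp [lowerThird, side]⟩ <;>
  · have := hc j
    by_cases h : j = i
    · subst h
      simp only [lowerThird, side, Function.update_self]
      grind
    · simp only [lowerThird, Function.update_of_ne h]
      grind

lemma upperThird_spec {c : Cell n} (hc : c.Proper) (i : Fin n) :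
    (c.upperThird i).Proper ∧ (c.upperThird i).Within c ∧ (c.upperThird i).side i = c.side i / 3 := by
  refine ⟨fun j => ?_, fun j => ?_, by simp [upperThird, side]⟩ <;>
  · have := hc j
    by_cases h : j = i
    · subst h
      simp only [upperThird, side, Function.update_self]
      grind
    · simp only [upperThird, Function.update_of_ne h]
      grind

lemma middleThird_spec {c : Cell n} (hc : c.Proper) (i : Fin n) :
    (c.middleThird i).Proper ∧ (c.middleThird i).Within c ∧
      (c.middleThird i).side i = c.side i / 3 := by
  refine ⟨fun j => ?_, fun j => ?_, by simp only [middleThird, side, Function.update_self]; ring⟩ <;>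
  · have := hc j
    by_cases h : j = i
    · subst h
      simp only [middleThird, side, Function.update_self]
      grind
    · simp only [middleThird, Function.update_of_ne h]
      grind

lemma center_middleThird (c : Cell n) (i : Fin n) : (c.middleThird i).center = c.center := by
  ext j
  by_cases h : j = i
  · subst h
    simp only [center, middleThird, Function.update_self]
    ring
  · simp only [center, middleThird, Function.update_of_ne h]

lemma mem_thirds {c : Cell n} {x : EuclideanSpace ℝ (Fin n)} (hx : x ∈ c.toSet) (i : Fin n) :
    x ∈ (c.lowerThird i).toSet ∨ x ∈ (c.upperThird i).toSet ∨ x ∈ (c.middleThird i).toSet := by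
  by_cases h1 : x i ≤ c.lo i + c.side i / 3
  · left
    intro j
    by_cases h : j = i
    · subst h
      simpa [lowerThird] using ⟨(hx j).1, h1⟩
    · simpa [lowerThird, h] using hx j
  by_cases h2 : c.hi i - c.side i / 3 ≤ x i
  · right; left
    intro j
    by_cases h : j = i
    · subst h
      simp only [upperThird, Function.update_self]
      exact ⟨h2, (hx j).2⟩
    · simpa [upperThird, h] using hx j
  · right; right
    intro j
    by_cases h : j = i
    · subst h
      simp only [middleThird, Function.update_self]
      exact ⟨(not_le.1 h1).le, (not_le.1 h2).le⟩
    · simpa [middleThird, h] using hx j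

lemma proper_within_of_mem_divide {is : List (Fin n)} {c d : Cell n} (hc : c.Proper)
    (hd : d ∈ divide is c) : d.Proper ∧ d.Within c := by
  induction is generalizing c with
  | nil =>
    obtain rfl : d = c := hd
    exact ⟨hc, .refl d⟩
  | cons i is ih =>
    rcases hd with (rfl | rfl) | hd
    · exact ⟨(lowerThird_spec hc i).1, (lowerThird_spec hc i).2.1⟩
    · exact ⟨(upperThird_spec hc i).1, (upperThird_spec hc i).2.1⟩
    · have hm := middleThird_spec hc i
      have h := ih hm.1 hd
      exact ⟨h.1, h.2.trans hm.2.1⟩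

lemma side_le_of_mem_divide_cons {i : Fin n} {is : List (Fin n)} {c d : Cell n} (hc : c.Proper)
    (hd : d ∈ divide (i :: is) c) : d.side i ≤ c.side i / 3 := by
  rcases hd with (rfl | rfl) | hd
  · exact (lowerThird_spec hc i).2.2.le
  · exact (upperThird_spec hc i).2.2.le
  · have hm := middleThird_spec hc i
    exact ((proper_within_of_mem_divide hm.1 hd).2.side_le i).trans hm.2.2.le

lemma exists_mem_divide (is : List (Fin n)) {c : Cell n} {x : EuclideanSpace ℝ (Fin n)}
    (hx : x ∈ c.toSet) : ∃ d ∈ divide is c, x ∈ d.toSet := by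
  induction is generalizing c with
  | nil => exact ⟨c, rfl, hx⟩
  | cons i is ih =>
    rcases mem_thirds hx i with h | h | h
    · exact ⟨_, .inl (.inl rfl), h⟩
    · exact ⟨_, .inl (.inr rfl), h⟩
    · obtain ⟨d, hd, hxd⟩ := ih h
      exact ⟨d, .inr hd, hxd⟩

/-- The innermost middle third is never moved off the centroid, so sampled points survive a
division. -/
lemma exists_center_eq_of_divide (is : List (Fin n)) (c : Cell n) :
    ∃ d ∈ divide is c, d.center = c.center := by
  induction is generalizing c with
  | nil => exact ⟨c, rfl, rfl⟩
  | cons i is ih =>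
    obtain ⟨d, hd, h⟩ := ih (c.middleThird i)
    exact ⟨d, .inr hd, h.trans (c.center_middleThird i)⟩

lemma finite_divide (is : List (Fin n)) (c : Cell n) : (divide is c).Finite := by
  induction is generalizing c with
  | nil => exact Set.finite_singleton c
  | cons i is ih => exact (Set.toFinite _).union (ih _)

/-- Each coordinate contributes two outer thirds, and one middle box remains at the end. -/
lemma ncard_divide_le (is : List (Fin n)) (c : Cell n) :
    (divide is c).ncard ≤ 2 * is.length + 1 := by
  induction is generalizing c with
  | nil => simp [divide]
  | cons i is ih =>
    refine (Set.ncard_union_le _ _).trans ?_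
    have h1 : ({c.lowerThird i, c.upperThird i} : Set (Cell n)).ncard ≤ 2 := by
      simpa using Set.ncard_insert_le (c.lowerThird i) {c.upperThird i}
    have h2 := ih (c.middleThird i)
    simp only [List.length_cons]
    omega

lemma Within.diag_le {c d : Cell n} (hc : c.Proper) (h : c.Within d) : c.diag ≤ d.diag := by
  refine le_of_sq_le_sq ?_ d.diag_nonneg
  rw [diag_sq, diag_sq]
  exact Finset.sum_le_sum fun i _ => pow_le_pow_left₀ (hc.side_nonneg i) (h.side_le i) 2

/-- Every part has at most a third of the side along the first coordinate, which costs 8/9 of its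
square; the other sides do not grow. -/
lemma diag_sq_le_of_mem_divide_cons {i : Fin n} {is : List (Fin n)} {c d : Cell n}
    (hc : c.Proper) (hd : d ∈ divide (i :: is) c) :
    d.diag ^ 2 ≤ c.diag ^ 2 - 8 / 9 * c.side i ^ 2 := by
  have hw := proper_within_of_mem_divide hc hd
  have h1 : d.side i ^ 2 ≤ (c.side i / 3) ^ 2 :=
    pow_le_pow_left₀ (hw.1.side_nonneg i) (side_le_of_mem_divide_cons hc hd) 2
  have h2 : ∑ j ∈ Finset.univ.erase i, d.side j ^ 2 ≤ ∑ j ∈ Finset.univ.erase i, c.side j ^ 2 :=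
    Finset.sum_le_sum fun j _ => pow_le_pow_left₀ (hw.1.side_nonneg j) (hw.2.side_le j) 2
  rw [diag_sq, diag_sq, ← Finset.add_sum_erase _ _ (Finset.mem_univ i),
    ← Finset.add_sum_erase _ (fun j => c.side j ^ 2) (Finset.mem_univ i)]
  linarith

/-- The diagonal of a box is controlled by a longest side, uniformly over all boxes. -/
lemma exists_diag_sq_le_of_isLongest {s : Fin n → ℝ} (hs : ∀ i, 0 < s i) :
    ∃ M : ℝ, 0 < M ∧ ∀ (c : Cell n) (i : Fin n), c.Proper → c.IsLongest s i →
      c.diag ^ 2 ≤ M * c.side i ^ 2 := by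
  -- Summing over `i` as well makes the constant independent of the longest side; the 1 keeps it
  -- positive when `n = 0`.
  refine ⟨1 + ∑ i, ∑ j, (s j / s i) ^ 2, by positivity, fun c i hc hi => ?_⟩
  have h1 : ∀ j, c.side j ≤ s j / s i * c.side i := fun j => by
    have := (div_le_iff₀ (hs j)).1 (hi j)
    calc c.side j ≤ c.side i / s i * s j := this
      _ = s j / s i * c.side i := by ring
  calc c.diag ^ 2 = ∑ j, c.side j ^ 2 := c.diag_sq
    _ ≤ ∑ j, (s j / s i) ^ 2 * c.side i ^ 2 := Finset.sum_le_sum fun j _ => by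
        rw [← mul_pow]
        exact pow_le_pow_left₀ (hc.side_nonneg j) (h1 j) 2
    _ = (∑ j, (s j / s i) ^ 2) * c.side i ^ 2 := by rw [Finset.sum_mul]
    _ ≤ (1 + ∑ i, ∑ j, (s j / s i) ^ 2) * c.side i ^ 2 := by
        refine mul_le_mul_of_nonneg_right ?_ (sq_nonneg _)
        have := Finset.single_le_sum (f := fun i => ∑ j, (s j / s i) ^ 2)
          (fun _ _ => by positivity) (Finset.mem_univ i)
        linarith

lemma exists_isLongest [NeZero n] (s : Fin n → ℝ) (c : Cell n) : ∃ i, c.IsLongest s i :=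
  Finite.exists_max fun i => c.side i / s i

/-- If a box with diagonal at least `δ` is divided, then the squares of the diagonals of the parts
are smaller by a fixed amount. -/
lemma exists_diag_sq_decrease {s : Fin n → ℝ} (hs : ∀ i, 0 < s i) {δ : ℝ} (hδ : 0 < δ) :
    ∃ γ : ℝ, 0 < γ ∧ ∀ (φ : EuclideanSpace ℝ (Fin n) → ℝ) (c d : Cell n) (is : List (Fin n)),
      c.Proper → δ ≤ c.diag → c.IsDivisionOrder φ s is → d ∈ divide is c →
        d.diag ^ 2 + γ ≤ c.diag ^ 2 := by
  obtain ⟨M, hM, h⟩ := exists_diag_sq_le_of_isLongest hs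
  refine ⟨8 / 9 * (δ ^ 2 / M), by positivity, fun φ c d is hc hδc his hd => ?_⟩
  -- A positive diagonal excludes `n = 0`, so a longest side exists and the list cannot be empty.
  have hn : NeZero n := ⟨by
    rintro rfl
    have := c.diag_sq
    simp only [Finset.univ_eq_empty, Finset.sum_empty] at this
    nlinarith⟩
  cases is with
  | nil =>
    obtain ⟨i, hi⟩ := exists_isLongest s c
    exact absurd ((his.2.1 i).2 hi) List.not_mem_nil
  | cons i is =>
    have h1 := h c i hc ((his.2.1 i).1 List.mem_cons_self)
    have h2 := diag_sq_le_of_mem_divide_cons hc hd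
    have h3 : δ ^ 2 / M ≤ c.side i ^ 2 := by
      rw [div_le_iff₀' hM]
      exact (pow_le_pow_left₀ hδ.le hδc 2).trans h1
    linarith

end Cell

/-! ### Termination of the division of large cells. -/

/-- A weight with natural values cannot decrease forever in a process which replaces the members
of finite sets by finitely many others. -/
lemma Finset.not_forall_exists_sum_lt {X : Type*} [DecidableEq X] (w : X → ℕ) (F : ℕ → Finset X)
    (ch : ℕ → X → Finset X) (hF : ∀ k, F (k + 1) = (F k).biUnion (ch k))
    (hle : ∀ k, ∀ c ∈ F k, ∑ d ∈ ch k c, w d ≤ w c) :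
    ¬ ∀ k, ∃ c ∈ F k, ∑ d ∈ ch k c, w d < w c := by
  intro hlt
  have hstep : ∀ k, ∑ c ∈ F (k + 1), w c < ∑ c ∈ F k, w c := fun k => by
    rw [hF]
    refine lt_of_le_of_lt ?_ (Finset.sum_lt_sum (hle k) (hlt k))
    -- Only an inequality, since different members may share replacements.
    have : ∀ T : Finset X, ∑ c ∈ T.biUnion (ch k), w c ≤ ∑ c ∈ T, ∑ d ∈ ch k c, w d := by
      intro T
      induction T using Finset.induction_on with
      | empty => simp
      | insert a T ha ih =>
        rw [Finset.biUnion_insert, Finset.sum_insert ha]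
        have := Finset.sum_union_inter (s₁ := ch k a) (s₂ := T.biUnion (ch k)) (f := w)
        omega
    exact this _
  exact not_strictAnti_of_wellFoundedLT _ (strictAnti_nat_of_succ_lt (f := fun k => ∑ c ∈ F k, w c) hstep)

namespace IsPartitionRun

variable {n : ℕ} {φ : EuclideanSpace ℝ (Fin n) → ℝ} {s l u : Fin n → ℝ}
  {sel : Set (Cell n) → Cell n → Prop} {H : ℕ → Set (Cell n)}

lemma finite (hH : IsPartitionRun φ s l u sel H) (k : ℕ) : (H k).Finite := by
  induction k with
  | zero => rw [hH.1]; exact Set.finite_singleton _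
  | succ k ih =>
    obtain ⟨order, -, h⟩ := hH.2 k
    rw [h]
    exact (ih.subset fun _ hc => hc.1).union
      ((ih.subset fun _ hc => hc.1).biUnion fun c _ => Cell.finite_divide _ c)

lemma proper_within (hH : IsPartitionRun φ s l u sel H) (hlu : ∀ i, l i ≤ u i) (k : ℕ) :
    ∀ c ∈ H k, c.Proper ∧ c.Within ⟨l, u⟩ := by
  induction k with
  | zero =>
    rw [hH.1]
    rintro c rfl
    exact ⟨hlu, .refl _⟩
  | succ k ih =>
    obtain ⟨order, -, h⟩ := hH.2 k
    rw [h]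
    rintro d (hd | hd)
    · exact ih d hd.1
    · simp only [Set.mem_iUnion] at hd
      obtain ⟨c, hc, hd⟩ := hd
      have h1 := ih c hc.1
      have h2 := Cell.proper_within_of_mem_divide h1.1 hd
      exact ⟨h2.1, h2.2.trans h1.2⟩

/-- The sampled points are kept. -/
lemma exists_center_eq (hH : IsPartitionRun φ s l u sel H) {k m : ℕ} (hkm : k ≤ m) {c : Cell n}
    (hc : c ∈ H k) : ∃ d ∈ H m, d.center = c.center := by
  induction m, hkm using Nat.le_induction with
  | base => exact ⟨c, hc, rfl⟩
  | succ m _ ih =>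
    obtain ⟨d, hd, hdc⟩ := ih
    obtain ⟨order, -, h⟩ := hH.2 m
    rw [h]
    by_cases hs : sel (H m) d
    · obtain ⟨e, he, hed⟩ := Cell.exists_center_eq_of_divide (order d) d
      exact ⟨e, .inr (Set.mem_biUnion (x := d) ⟨hd, hs⟩ he), hed.trans hdc⟩
    · exact ⟨d, .inl ⟨hd, hs⟩, hdc⟩

/-- A point of a cell stays in cells within that cell. -/
lemma exists_mem_within (hH : IsPartitionRun φ s l u sel H) (hlu : ∀ i, l i ≤ u i) {k m : ℕ}
    (hkm : k ≤ m) {c : Cell n} (hc : c ∈ H k) {x : EuclideanSpace ℝ (Fin n)} (hx : x ∈ c.toSet) :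
    ∃ d ∈ H m, x ∈ d.toSet ∧ d.Within c := by
  induction m, hkm using Nat.le_induction with
  | base => exact ⟨c, hc, hx, .refl c⟩
  | succ m _ ih =>
    obtain ⟨d, hd, hxd, hdc⟩ := ih
    obtain ⟨order, -, h⟩ := hH.2 m
    rw [h]
    by_cases hs : sel (H m) d
    · obtain ⟨e, he, hxe⟩ := Cell.exists_mem_divide (order d) hxd
      exact ⟨e, .inr (Set.mem_biUnion (x := d) ⟨hd, hs⟩ he), hxe,
        (Cell.proper_within_of_mem_divide (hH.proper_within hlu m d hd).1 he).2.trans hdc⟩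
    · exact ⟨d, .inl ⟨hd, hs⟩, hxd, hdc⟩

/-- Cells with diagonal at least `δ` are not selected in every iteration from some point on. -/
lemma not_forall_exists_sel (hH : IsPartitionRun φ s l u sel H) (hlu : ∀ i, l i ≤ u i)
    (hs : ∀ i, 0 < s i) {δ : ℝ} (hδ : 0 < δ) (k₀ : ℕ) :
    ¬ ∀ k, k₀ ≤ k → ∃ c ∈ H k, sel (H k) c ∧ δ ≤ c.diag := by
  classical
  intro hsel
  obtain ⟨γ, hγ, hdec⟩ := Cell.exists_diag_sq_decrease hs hδ
  choose order hord hnext using hH.2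
  -- The base exceeds the maximal number `2n + 1` of parts, and the exponent drops by at least one
  -- at each division of a large cell.
  let w : Cell n → ℕ := fun c =>
    if δ ≤ c.diag then (2 * n + 2) ^ ⌊c.diag ^ 2 / γ⌋₊ else 0
  let F : ℕ → Finset (Cell n) := fun k => (hH.finite (k₀ + k)).toFinset
  let ch : ℕ → Cell n → Finset (Cell n) := fun k c =>
    if sel (H (k₀ + k)) c then (Cell.finite_divide (order (k₀ + k) c) c).toFinset else {c}
  have hproper : ∀ k, ∀ c ∈ F k, c.Proper := fun k c hc =>
    (hH.proper_within hlu (k₀ + k) c (by simpa [F] using hc)).1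
  have hlt : ∀ k, ∀ c ∈ F k, sel (H (k₀ + k)) c → δ ≤ c.diag → ∑ d ∈ ch k c, w d < w c := by
    intro k c hc hsc hδc
    have ho := hord (k₀ + k) c (by simpa [F] using hc) hsc
    have hcard : (ch k c).card ≤ 2 * n + 1 := by
      have h1 := Cell.ncard_divide_le (order (k₀ + k) c) c
      rw [Set.ncard_eq_toFinset_card _ (Cell.finite_divide (order (k₀ + k) c) c)] at h1
      have h2 := ho.1.length_le_card
      rw [Fintype.card_fin] at h2
      simp only [ch, if_pos hsc]
      omega
    have hle : ∀ d ∈ ch k c, (2 * n + 2) * w d ≤ w c := by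
      intro d hd
      simp only [ch, if_pos hsc, Set.Finite.mem_toFinset] at hd
      have h1 := hdec φ c d _ (hproper k c hc) hδc ho hd
      by_cases hδd : δ ≤ d.diag
      · simp only [w, if_pos hδd, if_pos hδc]
        rw [← pow_succ']
        refine Nat.pow_le_pow_right (by omega) ?_
        rw [← Nat.floor_add_one (by positivity)]
        refine Nat.floor_le_floor ?_
        rw [div_add_one hγ.ne']
        exact div_le_div_of_nonneg_right h1 hγ.le
      · simp [w, if_neg hδd]
    have hpos : 0 < w c := by simp only [w, if_pos hδc]; positivity
    have h1 : (2 * n + 2) * ∑ d ∈ ch k c, w d ≤ (2 * n + 1) * w c := by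
      rw [Finset.mul_sum]
      exact (Finset.sum_le_card_nsmul _ _ _ hle).trans
        (by rw [smul_eq_mul]; exact Nat.mul_le_mul_right _ hcard)
    by_contra! hcon
    have := Nat.mul_le_mul_left (2 * n + 2) hcon
    nlinarith
  refine Finset.not_forall_exists_sum_lt w F ch (fun k => ?_) (fun k c hc => ?_) (fun k => ?_)
  · ext d
    have := Set.ext_iff.1 (hnext (k₀ + k)) d
    simp only [F, Set.Finite.mem_toFinset, Finset.mem_biUnion, ← add_assoc, this]
    simp only [ch, Set.mem_union, Set.mem_iUnion, Set.mem_ofPred_eq]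
    constructor
    · rintro (⟨hd, hsd⟩ | ⟨c, ⟨hc, hsc⟩, hd⟩)
      · exact ⟨d, hd, by simp [hsd]⟩
      · exact ⟨c, hc, by simpa [hsc] using hd⟩
    · rintro ⟨c, hc, hd⟩
      by_cases hsc : sel (H (k₀ + k)) c
      · exact .inr ⟨c, ⟨hc, hsc⟩, by simpa [hsc] using hd⟩
      · obtain rfl : d = c := by simpa [hsc] using hd
        exact .inl ⟨hc, hsc⟩
  · by_cases hsc : sel (H (k₀ + k)) c
    · by_cases hδc : δ ≤ c.diag
      · exact (hlt k c hc hsc hδc).le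
      -- Parts of a small cell are small, hence have weight 0.
      · refine (Finset.sum_eq_zero fun d hd => ?_).trans_le (Nat.zero_le _)
        simp only [ch, if_pos hsc, Set.Finite.mem_toFinset] at hd
        have h1 := Cell.proper_within_of_mem_divide (hproper k c hc) hd
        have h2 := h1.2.diag_le h1.1
        simp only [w]
        rw [if_neg fun h => hδc (h.trans h2)]
    · simp [ch, if_neg hsc]
  · obtain ⟨c, hc, hsc, hδc⟩ := hsel (k₀ + k) (Nat.le_add_right _ _)
    have hcF : c ∈ F k := by simpa [F] using hc
    exact ⟨c, hcF, hlt k c hcF hsc hδc⟩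

end IsPartitionRun

/-! ### Large cells are selected; sampling near minimum points. -/

/-- Among the cells of largest diagonal, those with the best value are potentially optimal. -/
lemma exists_potentiallyOptimal {n : ℕ} (φ : EuclideanSpace ℝ (Fin n) → ℝ) (ε : ℝ)
    {P : Set (Cell n)} (hP : P.Finite) {c : Cell n} (hc : c ∈ P) (hpos : 0 < c.diag) :
    ∃ h ∈ P, PotentiallyOptimal φ ε P h ∧ c.diag ≤ h.diag := by
  obtain ⟨m, hm, hmax⟩ := Set.exists_max_image P Cell.diag hP ⟨c, hc⟩
  obtain ⟨h, ⟨hh, hhm⟩, hmin⟩ := Set.exists_min_image {h ∈ P | h.diag = m.diag}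
    (fun h => φ h.center) (hP.subset fun _ h => h.1) ⟨m, hm, rfl⟩
  have hch : c.diag ≤ h.diag := (hmax c hc).trans hhm.ge
  have hhpos : 0 < h.diag := hpos.trans_le hch
  -- Against cells of equal diagonal the value decides for every `K`; against smaller ones a large
  -- `K` does. Finitely many such conditions hold for a common `K`.
  have hcell : ∀ d ∈ P, ∀ᶠ K : ℝ in Filter.atTop,
      φ h.center - K / 2 * h.diag ≤ φ d.center - K / 2 * d.diag := by
    intro d hd
    rcases (hmax d hd).eq_or_lt with hdm | hdm
    · have := hmin d ⟨hd, hdm⟩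
      refine .of_forall fun K => ?_
      rw [hhm, hdm]
      linarith
    · have hgap : 0 < h.diag - d.diag := by linarith
      filter_upwards [Filter.eventually_ge_atTop
        (2 * (φ h.center - φ d.center) / (h.diag - d.diag))] with K hK
      rw [div_le_iff₀ hgap] at hK
      linarith
  have hmin' : ∀ᶠ K : ℝ in Filter.atTop,
      φ h.center - K / 2 * h.diag ≤ phiMin φ P - ε * |phiMin φ P| := by
    filter_upwards [Filter.eventually_ge_atTop
      (2 * (φ h.center - (phiMin φ P - ε * |phiMin φ P|)) / h.diag)] with K hK
    rw [div_le_iff₀ hhpos] at hK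
    linarith
  obtain ⟨K, hK, hK1, hK2⟩ := ((Filter.eventually_gt_atTop 0).and
    ((hP.eventually_all.2 hcell).and hmin')).exists
  exact ⟨h, hh, ⟨K, hK, hK1, hK2⟩, hch⟩

/-- DIRECT samples points arbitrarily close to every point of the feasible box. -/
lemma IsDirectRun.exists_center_mem {n : ℕ} {φ : EuclideanSpace ℝ (Fin n) → ℝ}
    {s l u : Fin n → ℝ} {ε : ℝ} {H : ℕ → Set (Cell n)} (hH : IsDirectRun φ s l u ε H)
    (hlu : ∀ i, l i ≤ u i) (hs : ∀ i, 0 < s i) {x : EuclideanSpace ℝ (Fin n)}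
    (hx : x ∈ (Cell.mk l u).toSet) {U : Set (EuclideanSpace ℝ (Fin n))} (hU : U ∈ 𝓝 x) :
    ∃ k, ∃ c ∈ H k, c.center ∈ U := by
  obtain ⟨r, hr, hrU⟩ := Metric.mem_nhds_iff.1 hU
  by_contra! hcon
  refine IsPartitionRun.not_forall_exists_sel hH hlu hs hr 0 fun k _ => ?_
  obtain ⟨c, hc, hxc, -⟩ := IsPartitionRun.exists_mem_within hH hlu (Nat.zero_le k)
    (c := ⟨l, u⟩) (by rw [hH.1]; rfl) hx
  have hrc : r ≤ c.diag := by
    have h1 := Cell.dist_center_le hxc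
    have h2 : r ≤ dist c.center x := not_lt.1 fun h => hcon k c hc (hrU h)
    linarith
  obtain ⟨h, hh, hopt, hch⟩ := exists_potentiallyOptimal φ ε
    (IsPartitionRun.finite hH k) hc (hr.trans_le hrc)
  exact ⟨h, hh, hopt, hrc.trans hch⟩

lemma exists_lipschitzOnWith_of_lipConst_lt {n : ℕ} {φ : EuclideanSpace ℝ (Fin n) → ℝ}
    {S : Set (EuclideanSpace ℝ (Fin n))} {a : ℝ} (h : lipConst φ S < ENNReal.ofReal a) :
    ∃ K : ℝ≥0, LipschitzOnWith K φ S ∧ (K : ℝ) < a := by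
  simp only [lipConst, iInf_lt_iff] at h
  obtain ⟨K, hK, hlt⟩ := h
  rw [ENNReal.ofReal, ENNReal.coe_lt_coe] at hlt
  exact ⟨K, hK, Real.lt_toNNReal_iff_coe_lt.1 hlt⟩

/-- `Lbar`-DIRECT samples points arbitrarily close to a global minimum point around which `Lbar`
overestimates the Lipschitz constant. -/
lemma IsLbarDirectRun.exists_center_mem {n : ℕ} {φ : EuclideanSpace ℝ (Fin n) → ℝ}
    {s l u : Fin n → ℝ} {ε η Lbar : ℝ} {H : ℕ → Set (Cell n)}
    (hH : IsLbarDirectRun φ s l u ε η Lbar H) (hlu : ∀ i, l i ≤ u i) (hs : ∀ i, 0 < s i)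
    (hLbar : 0 < Lbar) {x : EuclideanSpace ℝ (Fin n)}
    (hx : IsGlobalMinPoint φ (Cell.mk l u).toSet x) {k₀ : ℕ} {c₀ : Cell n} (hc₀ : c₀ ∈ H k₀)
    (hxc₀ : x ∈ c₀.toSet) (hlip : lipConst φ c₀.toSet < ENNReal.ofReal Lbar)
    {U : Set (EuclideanSpace ℝ (Fin n))} (hU : U ∈ 𝓝 x) :
    ∃ k, ∃ c ∈ H k, c.center ∈ U := by
  obtain ⟨L, hL, hLlt⟩ := exists_lipschitzOnWith_of_lipConst_lt hlip
  obtain ⟨r, hr, hrU⟩ := Metric.mem_nhds_iff.1 hU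
  by_contra! hcon
  -- This threshold is the lower bound for `h.diag` obtained by combining `h1`, `h2`, `h3` and `h4`
  -- below.
  have hδ : 0 < (Lbar - L) * r / Lbar := by
    have := sub_pos.2 hLlt
    positivity
  refine IsPartitionRun.not_forall_exists_sel hH hlu hs hδ k₀ fun k hk => ?_
  obtain ⟨c, hc, hxc, hcc₀⟩ := IsPartitionRun.exists_mem_within hH hlu hk hc₀ hxc₀
  have hdist := Cell.dist_center_le hxc
  have hrc : r ≤ c.diag := by
    have h2 : r ≤ dist c.center x := not_lt.1 fun h => hcon k c hc (hrU h)
    have := c.diag_nonneg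
    linarith
  obtain ⟨h, hh, hmin⟩ := Set.exists_min_image (H k)
    (fun c => φ c.center - Lbar / 2 * c.diag) (IsPartitionRun.finite hH k) ⟨c, hc⟩
  refine ⟨h, hh, .inr hmin, ?_⟩
  have hproper := IsPartitionRun.proper_within hH hlu k
  have h1 : φ x ≤ φ h.center :=
    hx.2 _ ((hproper h hh).2.toSet_subset (hproper h hh).1.center_mem)
  -- The cell `c` lies within `c₀`, so the Lipschitz bound on `c₀` applies to it.
  have h2 : φ c.center - φ x ≤ L * (c.diag / 2) :=
    (le_abs_self _).trans <| (hL.dist_le_mul _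
      (hcc₀.toSet_subset (hproper c hc).1.center_mem) _ hxc₀).trans
      (mul_le_mul_of_nonneg_left hdist L.2)
  have h3 := hmin c hc
  have h4 : (Lbar - L) * r ≤ (Lbar - L) * c.diag :=
    mul_le_mul_of_nonneg_left hrc (sub_nonneg.2 hLlt.le)
  rw [div_le_iff₀ hLbar]
  linarith

theorem mainTheorem4 {n : ℕ} (l u : Fin n → ℝ) (hlu : ∀ i, l i ≤ u i)
    (C : Set (EuclideanSpace ℝ (Fin n))) (hC : C = (Cell.mk l u).toSet)
    (f : EuclideanSpace ℝ (Fin n) → EuclideanSpace ℝ (Fin n) → ℝ)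
    (hf : Continuous (fun p : EuclideanSpace ℝ (Fin n) × EuclideanSpace ℝ (Fin n) => f p.1 p.2))
    (hconv : ∀ x ∈ C, ConvexOn ℝ Set.univ (f x))
    (hdiag : ∀ x ∈ C, f x x = 0)
    (α : ℝ) (hα : 0 ≤ α)
    (s : Fin n → ℝ) (hs : ∀ i, 0 < s i)
    (ε : ℝ) (hε : 0 < ε) (ε' : ℝ) (hε' : 0 < ε') (η : ℝ) (hη : 0 < η)
    (Lbar : ℝ) (hLbar : 0 < Lbar)
    (H : ℕ → Set (Cell n)) (hH : IsDirectRun (gapFunction f C α) s l u ε H)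
    (H' : ℕ → Set (Cell n)) (hH' : IsLbarDirectRun (gapFunction f C α) s l u ε' η Lbar H') :
    (∀ x, IsGlobalMinPoint (gapFunction f C α) C x → ∀ U ∈ 𝓝 x,
      ∃ k, ∃ c ∈ H k, c.center ∈ U) ∧
    (OverestimatesLocally (gapFunction f C α) C Lbar H' →
      ∀ x, IsGlobalMinPoint (gapFunction f C α) C x → ∀ U ∈ 𝓝 x,
        ∃ k, (∃ c ∈ H k, c.center ∈ U) ∧ (∃ c ∈ H' k, c.center ∈ U)) := by
  subst hC
  have key : ∀ x, IsGlobalMinPoint (gapFunction f (Cell.mk l u).toSet α) (Cell.mk l u).toSet x →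
      ∀ U ∈ 𝓝 x, ∃ k, ∃ c ∈ H k, c.center ∈ U :=
    fun x hx U hU => hH.exists_center_mem hlu hs hx.1 hU
  refine ⟨key, fun hL x hx U hU => ?_⟩
  obtain ⟨k, c, hc, hcU⟩ := key x hx U hU
  obtain ⟨k₀, c₀, hc₀, hxc₀, hlip⟩ := hL x hx
  obtain ⟨k', c', hc', hcU'⟩ := hH'.exists_center_mem hlu hs hLbar hx hc₀ hxc₀ hlip hU
  -- Centroids persist, so both runs can be read at the later of the two indices.
  obtain ⟨d, hd, hdc⟩ := IsPartitionRun.exists_center_eq hH (le_max_left k k') hc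
  obtain ⟨d', hd', hdc'⟩ := IsPartitionRun.exists_center_eq hH' (le_max_right k k') hc'
  exact ⟨max k k', ⟨d, hd, hdc ▸ hcU⟩, d', hd', hdc' ▸ hcU'⟩
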